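/- Let $S=K[x_1,\dots,x_n]$ be a polynomial ring over an algebraically closed field $K$ of characteristic $0$. All monomial orders $\tau$ are graded ($\deg f>\deg g$ implies $f>_\tau g$), multiplicative total orders on the monomials of $S$ with $x_1>_\tau x_2>_\tau\dots>_\tau x_n$. For an ideal $I\subseteq S$ let $\mathrm{in}_\tau(I)$ be the ideal generated by the $\tau$-initial terms of the elements of $I$, and let the generic initial ideal $\mathrm{gin}_\tau(I)$ be the ideal that equals $\mathrm{in}_\tau(g(I))$ for all $g$ in some nonempty Zariski open subset of $GL_n(K)$, where $g$ acts on $S$ by linear changes of coordinates. For an ideal $J$, let $J_d$ denote the space of its homogeneous elements of degree $d$ (together with $0$). **Theorem 3.8.** Let $\tau_1,\tau_2$ be two such monomial orders. Then $\mathrm{gin}_{\tau_1}(I)=\mathrm{gin}_{\tau_2}(I)$ for all ideals $I\subseteq S$ if and only if $\tau_1=\tau_2$. More precisely, for each $d$ let $M_1>_{\tau_1}M_2>_{\tau_1}\cdots$ and $M_1'>_{\tau_2}M_2'>_{\tau_2}\cdots$ be the lists of all monomials of degree $d$ in decreasing order. If $\tau_1\neq\tau_2$, then these two lists differ for some $d$.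 Whenever they differ in degree $d$, let $k$ be the least index with $M_k\neq M_k'$, and let $I=(M_1,\dots,M_{k-1},\,M_k+M_k')$. Then $\mathrm{gin}_{\tau_1}(I)$ and $\mathrm{gin}_{\tau_2}(I)$ exist, and $$\mathrm{gin}_{\tau_1}(I)_d=\langle M_1,\dots,M_{k-1},M_k\rangle_K\;\neq\;\langle M_1,\dots,M_{k-1},M_k'\rangle_K=\mathrm{gin}_{\tau_2}(I)_d .$$ -/

import Mathlib

open scoped MonomialOrder

/-! Generic initial ideals in `K[x_1, …, x_n]`, the variables being indexed by `Fin n`.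
Monomials are identified with their exponent vectors `a : Fin n →₀ ℕ`, and monomial orders are
Mathlib's `MonomialOrder (Fin n)`; `a ≼[τ] b` says that `x^a ≤ x^b` with respect to `τ`. -/

namespace GenericInitial

open MvPolynomial

/-- The conventions on monomial orders: the order is graded, and `x_1 > x_2 > ⋯ > x_n`.
(Totality and multiplicativity are part of `MonomialOrder`.) -/
structure IsGradedStandard {n : ℕ} (τ : MonomialOrder (Fin n)) : Prop where
  graded : ∀ a b : Fin n →₀ ℕ, a.degree < b.degree → a ≺[τ] b
  vars : ∀ i j : Fin n, i < j → Finsupp.single j 1 ≺[τ] Finsupp.single i 1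

/-- The initial ideal `in_τ(I)`, generated by the initial terms of the elements of `I`. -/
noncomputable def initialIdeal {n : ℕ} {K : Type*} [Field K] (τ : MonomialOrder (Fin n))
    (I : Ideal (MvPolynomial (Fin n) K)) : Ideal (MvPolynomial (Fin n) K) :=
  Ideal.span (τ.leadingTerm '' (I : Set (MvPolynomial (Fin n) K)))

/-- The linear change of coordinates `x_j ↦ ∑ i, g_{ij} x_i`, as a `K`-algebra homomorphism. -/
noncomputable def coordChange {n : ℕ} {K : Type*} [Field K] (g : GL (Fin n) K) :
    MvPolynomial (Fin n) K →ₐ[K] MvPolynomial (Fin n) K :=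
  aeval fun j => ∑ i, C ((g : Matrix (Fin n) (Fin n) K) i j) * X i

/-- A subset of `GL_n(K)` is Zariski open if its complement is the common zero set in `GL_n(K)`
of a family of polynomials in the matrix entries. -/
def IsZariskiOpen {n : ℕ} {K : Type*} [Field K] (U : Set (GL (Fin n) K)) : Prop :=
  ∃ s : Set (MvPolynomial (Fin n × Fin n) K),
    U = {g : GL (Fin n) K | ∃ p ∈ s, eval (fun e => (g : Matrix (Fin n) (Fin n) K) e.1 e.2) p ≠ 0}

/-- `J` is the generic initial ideal of `I`: one has `in_τ(g(I)) = J` for all `g` in some nonempty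
Zariski open subset of `GL_n(K)`. -/
def IsGenericInitialIdeal {n : ℕ} {K : Type*} [Field K] (τ : MonomialOrder (Fin n))
    (I J : Ideal (MvPolynomial (Fin n) K)) : Prop :=
  ∃ U : Set (GL (Fin n) K), IsZariskiOpen U ∧ U.Nonempty ∧
    ∀ g ∈ U, initialIdeal τ (I.map (coordChange g)) = J

/-- Any two nonempty Zariski open subsets of `GL_n(K)` meet. -/
theorem IsZariskiOpen.inter_nonempty {n : ℕ} {K : Type*} [Field K] [Infinite K]
    {U V : Set (GL (Fin n) K)} (hU : IsZariskiOpen U) (hV : IsZariskiOpen V)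
    (hU' : U.Nonempty) (hV' : V.Nonempty) : (U ∩ V).Nonempty := by
  obtain ⟨s, rfl⟩ := hU
  obtain ⟨t, rfl⟩ := hV
  obtain ⟨g, p, hp, hgp⟩ := hU'
  obtain ⟨h, q, hq, hhq⟩ := hV'
  have hp0 : p ≠ 0 := by rintro rfl; simp at hgp
  have hq0 : q ≠ 0 := by rintro rfl; simp at hhq
  have hd0 : (Matrix.mvPolynomialX (Fin n) (Fin n) K).det ≠ 0 := Matrix.det_mvPolynomialX_ne_zero _ _
  have hne : p * q * (Matrix.mvPolynomialX (Fin n) (Fin n) K).det ≠ 0 :=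
    mul_ne_zero (mul_ne_zero hp0 hq0) hd0
  obtain ⟨x, hx⟩ : ∃ x, eval x (p * q * (Matrix.mvPolynomialX (Fin n) (Fin n) K).det) ≠ 0 := by
    by_contra! hcon
    exact hne (MvPolynomial.funext fun x => by rw [hcon x, map_zero])
  rw [map_mul, map_mul] at hx
  have hdet : (Matrix.of fun i j => x (i, j)).det ≠ 0 := by
    intro h0
    apply hx
    rw [RingHom.map_det]
    have : (eval x).mapMatrix (Matrix.mvPolynomialX (Fin n) (Fin n) K)
        = Matrix.of fun i j => x (i, j) := by
      ext i j; simp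
    rw [this, h0, mul_zero]
  refine ⟨Matrix.GeneralLinearGroup.mkOfDetNeZero _ hdet, ⟨p, hp, ?_⟩, ⟨q, hq, ?_⟩⟩
  · exact left_ne_zero_of_mul (left_ne_zero_of_mul hx)
  · exact right_ne_zero_of_mul (left_ne_zero_of_mul hx)

/-- Over an infinite field a generic initial ideal is unique. -/
theorem IsGenericInitialIdeal.unique {n : ℕ} {K : Type*} [Field K] [Infinite K]
    {τ : MonomialOrder (Fin n)} {I J J' : Ideal (MvPolynomial (Fin n) K)}
    (h : IsGenericInitialIdeal τ I J) (h' : IsGenericInitialIdeal τ I J') : J = J' := by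
  obtain ⟨U, hU, hU', hJ⟩ := h
  obtain ⟨V, hV, hV', hJ'⟩ := h'
  obtain ⟨g, hgU, hgV⟩ := hU.inter_nonempty hV hU' hV'
  exact (hJ g hgU).symm.trans (hJ' g hgV)

/-- The generic initial ideal `gin_τ(I)`: the ideal `J` with `IsGenericInitialIdeal τ I J`
(and an arbitrary ideal should there be none). -/
noncomputable def gin {n : ℕ} {K : Type*} [Field K] (τ : MonomialOrder (Fin n))
    (I : Ideal (MvPolynomial (Fin n) K)) : Ideal (MvPolynomial (Fin n) K) :=
  Classical.epsilon (IsGenericInitialIdeal τ I)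

/-- The list of all monomials of degree `d`, in `τ`-decreasing order. -/
noncomputable def monomialList {n : ℕ} (τ : MonomialOrder (Fin n)) (d : ℕ) :
    List (Fin n →₀ ℕ) :=
  ((((Finset.univ : Finset (Fin n)).finsuppAntidiag d).map τ.toSyn.toEquiv.toEmbedding).sort
    (· ≥ ·)).map τ.toSyn.symm

/-- The (zero-based) position `k` is the first one at which the lists `L` and `L'` differ, and
the entries there are `m` and `m'`. -/
def IsFirstDifference {α : Type*} (L L' : List α) (k : ℕ) (m m' : α) : Prop :=
  L.take k = L'.take k ∧ L[k]? = some m ∧ L'[k]? = some m' ∧ m ≠ m'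

/-- The ideal generated by the monomials in the list `L` and by the binomial `x^m + x^m'`. -/
noncomputable def monomialBinomialIdeal {n : ℕ} (K : Type*) [Field K] (L : List (Fin n →₀ ℕ))
    (m m' : Fin n →₀ ℕ) : Ideal (MvPolynomial (Fin n) K) :=
  Ideal.span ((fun a => monomial a (1 : K)) '' {a | a ∈ L} ∪
    {monomial m (1 : K) + monomial m' (1 : K)})

/-- The degree `d` part `J_d` of an ideal `J`, that is, the `K`-vector space of the homogeneous
polynomials of degree `d` (and zero) in `J`. -/
noncomputable def degreePart {n : ℕ} {K : Type*} [Field K]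
    (J : Ideal (MvPolynomial (Fin n) K)) (d : ℕ) : Submodule K (MvPolynomial (Fin n) K) :=
  J.restrictScalars K ⊓ homogeneousSubmodule (Fin n) K d

/-- The `K`-linear span of the monomials in the list `L`. -/
noncomputable def monomialSpan {n : ℕ} (K : Type*) [Field K] (L : List (Fin n →₀ ℕ)) :
    Submodule K (MvPolynomial (Fin n) K) :=
  Submodule.span K ((fun a => monomial a (1 : K)) '' {a | a ∈ L})

end GenericInitial

/-! Generic initial ideals over an infinite field, and how they determine the monomial order.

Let `V` be a finite-dimensional space of polynomials. The leading exponents of the nonzero elements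
of `V` are as many as its dimension (`ncard_leadExponents`). Given a coordinate change `g₀` and a
set `T` of exponents closed under passing to `τ`-larger ones, choose elements of `V` whose images
under `g₀` realize the leading exponents in `T`. Their coefficient matrix at these exponents is
triangular, so its determinant, as a polynomial in the entries of `g`, is not zero. Wherever it
does not vanish, `g(V)` has at least as many leading exponents in `T` as `g₀(V)`
(`eventually_ncard_leadExponents_inter_le`). As these numbers, for all `T` of the form "everything
above `a`", determine a finite set of exponents, the leading exponents of `g(V)` are constant for
generic `g`.

For an ideal `I` this applies to its elements of degree at most `e`, for each `e`; a graded order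
sees the total degree in the leading exponent. That finitely many `e` suffice is Dickson's lemma
together with the invariance of the Hilbert function under `g`
(`exists_eventually_leadExponents_eq`). Hence every ideal has a generic initial ideal.

If the lists of monomials of degree `d` for two orders first differ with `m` and `m'`, then the
ideal generated by the common initial segment and `m + m'` has `m` as its last leading monomial of
degree `d` for the first order and `m'` for the second. These leading monomials of degree `d` are
already the largest possible ones before any coordinate change. By semicontinuity they remain the
leading monomials after a generic one (`degreePart_gin_monomialBinomialIdeal`), so the two generic
initial ideals differ in degree `d`. -/

namespace GenericInitial

open MvPolynomial Module

variable {n : ℕ} {K : Type*} [Field K]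

/-! ### Leading exponents of a space of polynomials -/

/-- The exponents of the `τ`-leading monomials of the nonzero elements of `V`. -/
def leadExponents (τ : MonomialOrder (Fin n)) (V : Submodule K (MvPolynomial (Fin n) K)) :
    Set (Fin n →₀ ℕ) :=
  {a | ∃ f ∈ V, f ≠ 0 ∧ τ.degree f = a}

/-- The coefficient matrix of polynomials with distinct leading exponents, taken at these
exponents, is triangular, hence has trivial kernel. -/
theorem exists_coeff_sum_ne_zero (τ : MonomialOrder (Fin n)) {S : Finset (Fin n →₀ ℕ)}
    {f : S → MvPolynomial (Fin n) K} (hf0 : ∀ j, f j ≠ 0) (hf : ∀ j, τ.degree (f j) = j)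
    {c : S → K} (hc : c ≠ 0) : ∃ i : S, coeff i (∑ j, c j • f j) ≠ 0 := by
  classical
  obtain ⟨j₀, hj₀⟩ := Function.ne_iff.mp hc
  obtain ⟨j, hj, hmax⟩ := Finset.exists_max_image
    (Finset.univ.filter fun j => c j ≠ 0) (fun j => τ.toSyn j) ⟨j₀, by simpa using hj₀⟩
  refine ⟨j, ?_⟩
  rw [coeff_sum, Finset.sum_eq_single j]
  · rw [coeff_smul, smul_eq_mul]
    refine mul_ne_zero (by simpa using hj) ?_
    have := τ.coeff_degree_ne_zero_iff.mpr (hf0 j)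
    rwa [hf j] at this
  · intro k _ hkj
    by_cases hk : c k = 0
    · simp [hk]
    · rw [coeff_smul, τ.coeff_eq_zero_of_lt, smul_zero]
      rw [hf k]
      refine lt_of_le_of_ne (hmax k (by simpa using hk)) fun h => hkj ?_
      exact Subtype.ext (τ.toSyn.injective h)
  · simp

theorem card_le_finrank_of_subset_leadExponents (τ : MonomialOrder (Fin n))
    {V : Submodule K (MvPolynomial (Fin n) K)} [FiniteDimensional K V]
    {S : Finset (Fin n →₀ ℕ)} (hS : (S : Set (Fin n →₀ ℕ)) ⊆ leadExponents τ V) :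
    S.card ≤ finrank K V := by
  choose f hfV hf0 hf using fun j : S => hS j.2
  have hli : LinearIndependent K fun j : S => (⟨f j, hfV j⟩ : V) := by
    rw [Fintype.linearIndependent_iff]
    intro c hc
    by_contra! hne
    obtain ⟨i, hi⟩ := exists_coeff_sum_ne_zero τ hf0 hf (c := c)
      (fun h => by obtain ⟨i, hi⟩ := hne; exact hi (congrFun h i))
    apply hi
    have := congrArg Subtype.val hc
    simp only [Submodule.coe_sum, Submodule.coe_smul, Submodule.coe_zero] at this
    rw [this, coeff_zero]
  simpa using hli.fintype_card_le_finrank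

/-- A space of polynomials that is detected by the coefficients at `S` has dimension at most
`S.card`. -/
theorem finrank_le_card_of_coeff_ne_zero {V : Submodule K (MvPolynomial (Fin n) K)}
    {S : Finset (Fin n →₀ ℕ)} (h : ∀ f ∈ V, f ≠ 0 → ∃ i ∈ S, coeff i f ≠ 0) :
    finrank K V ≤ S.card := by
  let φ : V →ₗ[K] (S → K) := LinearMap.pi fun i => (lcoeff K (i : Fin n →₀ ℕ)).comp V.subtype
  have hφ : Function.Injective φ := by
    rw [← LinearMap.ker_eq_bot, LinearMap.ker_eq_bot']
    intro f hf
    by_contra hne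
    obtain ⟨i, hi, hci⟩ := h f f.2 (fun h => hne (Subtype.ext h))
    exact hci (congrFun hf ⟨i, hi⟩)
  simpa using LinearMap.finrank_le_finrank_of_injective hφ

theorem leadExponents_finite (τ : MonomialOrder (Fin n))
    (V : Submodule K (MvPolynomial (Fin n) K)) [FiniteDimensional K V] :
    (leadExponents τ V).Finite := by
  by_contra hinf
  obtain ⟨S, hS, hcard⟩ := Set.Infinite.exists_subset_card_eq hinf (finrank K V + 1)
  have := card_le_finrank_of_subset_leadExponents τ hS
  omega

theorem ncard_leadExponents (τ : MonomialOrder (Fin n))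
    (V : Submodule K (MvPolynomial (Fin n) K)) [FiniteDimensional K V] :
    (leadExponents τ V).ncard = finrank K V := by
  have hfin := leadExponents_finite τ V
  rw [Set.ncard_eq_toFinset_card _ hfin]
  refine le_antisymm (card_le_finrank_of_subset_leadExponents τ (by simp)) ?_
  refine finrank_le_card_of_coeff_ne_zero fun f hf hf0 => ⟨τ.degree f, ?_, ?_⟩
  · rw [Set.Finite.mem_toFinset]
    exact ⟨f, hf, hf0, rfl⟩
  · exact τ.coeff_degree_ne_zero_iff.mpr hf0

/-- If the coefficients at the exponents in `S ⊆ T` detect a subspace of `V` and `T` is closed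
under passing to `τ`-larger exponents, then `V` has enough leading exponents in `T`. -/
theorem finrank_le_ncard_leadExponents_inter (τ : MonomialOrder (Fin n))
    {V W : Submodule K (MvPolynomial (Fin n) K)} [FiniteDimensional K V] (hWV : W ≤ V)
    {S : Finset (Fin n →₀ ℕ)} {T : Set (Fin n →₀ ℕ)} (hST : (S : Set (Fin n →₀ ℕ)) ⊆ T)
    (hT : ∀ a ∈ T, ∀ b, a ≼[τ] b → b ∈ T)
    (h : ∀ f ∈ W, f ≠ 0 → ∃ i ∈ S, coeff i f ≠ 0) :
    finrank K W ≤ (leadExponents τ V ∩ T).ncard := by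
  have := Submodule.finiteDimensional_of_le hWV
  rw [← ncard_leadExponents τ W]
  refine Set.ncard_le_ncard ?_ ((leadExponents_finite τ V).inter_of_left T)
  rintro a ⟨f, hf, hf0, rfl⟩
  obtain ⟨i, hi, hci⟩ := h f hf hf0
  exact ⟨⟨f, hWV hf, hf0, rfl⟩, hT i (hST hi) _ (τ.le_degree (mem_support_iff.mpr hci))⟩

/-! ### Generic coordinate changes -/

/-- The filter of those sets of invertible matrices that contain the non-vanishing locus of a
nonzero polynomial in the matrix entries. Over an infinite field these are the sets with
nonempty Zariski interior. -/
def genericFilter (n : ℕ) (K : Type*) [Field K] : Filter (GL (Fin n) K) where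
  sets := {U | ∃ p : MvPolynomial (Fin n × Fin n) K, p ≠ 0 ∧
    ∀ g : GL (Fin n) K, eval (fun e => (g : Matrix (Fin n) (Fin n) K) e.1 e.2) p ≠ 0 → g ∈ U}
  univ_sets := ⟨1, one_ne_zero, fun _ _ => trivial⟩
  sets_of_superset := by
    rintro U V ⟨p, hp, h⟩ hUV
    exact ⟨p, hp, fun g hg => hUV (h g hg)⟩
  inter_sets := by
    rintro U V ⟨p, hp, h⟩ ⟨q, hq, h'⟩
    refine ⟨p * q, mul_ne_zero hp hq, fun g hg => ?_⟩
    rw [map_mul] at hg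
    exact ⟨h g (left_ne_zero_of_mul hg), h' g (right_ne_zero_of_mul hg)⟩

theorem eventually_genericFilter_iff {P : GL (Fin n) K → Prop} :
    (∀ᶠ g in genericFilter n K, P g) ↔ ∃ p : MvPolynomial (Fin n × Fin n) K, p ≠ 0 ∧
      ∀ g : GL (Fin n) K, eval (fun e => (g : Matrix (Fin n) (Fin n) K) e.1 e.2) p ≠ 0 → P g :=
  Iff.rfl

/-- A nonzero polynomial in the matrix entries is nonzero at some invertible matrix, because its
product with the determinant is a nonzero polynomial. -/
theorem exists_eval_ne_zero [Infinite K] {p : MvPolynomial (Fin n × Fin n) K} (hp : p ≠ 0) :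
    ∃ g : GL (Fin n) K, eval (fun e => (g : Matrix (Fin n) (Fin n) K) e.1 e.2) p ≠ 0 := by
  obtain ⟨x, hx⟩ : ∃ x, eval x (p * (Matrix.mvPolynomialX (Fin n) (Fin n) K).det) ≠ 0 := by
    by_contra! hcon
    exact mul_ne_zero hp (Matrix.det_mvPolynomialX_ne_zero _ _)
      (MvPolynomial.funext fun x => by rw [hcon x, map_zero])
  rw [map_mul, RingHom.map_det] at hx
  have hX : (eval x).mapMatrix (Matrix.mvPolynomialX (Fin n) (Fin n) K)
      = Matrix.of fun i j => x (i, j) := by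
    ext i j; simp
  rw [hX] at hx
  exact ⟨Matrix.GeneralLinearGroup.mkOfDetNeZero _ (right_ne_zero_of_mul hx),
    left_ne_zero_of_mul hx⟩

instance [Infinite K] : (genericFilter n K).NeBot := by
  refine Filter.neBot_iff.mpr fun h => ?_
  obtain ⟨p, hp, hpU⟩ : (∅ : Set (GL (Fin n) K)) ∈ genericFilter n K := by
    rw [h]; exact Filter.mem_bot
  obtain ⟨g, hg⟩ := exists_eval_ne_zero hp
  exact hpU g hg

theorem isGenericInitialIdeal_of_eventually [Infinite K] {τ : MonomialOrder (Fin n)}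
    {I J : Ideal (MvPolynomial (Fin n) K)}
    (h : ∀ᶠ g in genericFilter n K, initialIdeal τ (I.map (coordChange g)) = J) :
    IsGenericInitialIdeal τ I J := by
  obtain ⟨p, hp, h⟩ := h
  refine ⟨{g | eval (fun e => (g : Matrix (Fin n) (Fin n) K) e.1 e.2) p ≠ 0}, ⟨{p}, by simp⟩,
    exists_eval_ne_zero hp, h⟩

theorem coordChange_comp_of_mul_eq_one {g h : GL (Fin n) K} (hgh : g * h = 1)
    (f : MvPolynomial (Fin n) K) : coordChange g (coordChange h f) = f := by
  suffices H : (coordChange g).comp (coordChange h) = AlgHom.id K _ from DFunLike.congr_fun H f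
  ext j : 1
  simp only [coordChange, AlgHom.comp_apply, aeval_X, map_sum, map_mul, AlgHom.coe_id, id_eq]
  have hM : (g : Matrix (Fin n) (Fin n) K) * (h : Matrix (Fin n) (Fin n) K) = 1 := by
    rw [← Units.val_mul, hgh, Units.val_one]
  calc ∑ i, aeval (fun j => ∑ i, C ((g : Matrix (Fin n) (Fin n) K) i j) * X i)
          (C ((h : Matrix (Fin n) (Fin n) K) i j)) *
          ∑ k, C ((g : Matrix (Fin n) (Fin n) K) k i) * X k
      = ∑ k, C (((g : Matrix (Fin n) (Fin n) K) * (h : Matrix (Fin n) (Fin n) K)) k j) * X k := by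
        simp only [algHom_C, algebraMap_eq, Matrix.mul_apply, map_sum, map_mul, Finset.sum_mul,
          Finset.mul_sum]
        rw [Finset.sum_comm]
        refine Finset.sum_congr rfl fun k _ => Finset.sum_congr rfl fun i _ => by ring
    _ = X j := by
        rw [hM, Finset.sum_eq_single j]
        · simp
        · intro k _ hk; simp [Matrix.one_apply_ne hk]
        · simp

theorem coordChange_one : coordChange (1 : GL (Fin n) K) = AlgHom.id K _ := by
  ext j : 1
  rw [coordChange, aeval_X, Finset.sum_eq_single j]
  · simp
  · intro i _ hij
    simp [Matrix.one_apply_ne hij]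
  · simp

theorem coordChange_inv_apply (g : GL (Fin n) K) (f : MvPolynomial (Fin n) K) :
    coordChange g (coordChange g⁻¹ f) = f :=
  coordChange_comp_of_mul_eq_one (mul_inv_cancel g) f

theorem coordChange_apply_inv (g : GL (Fin n) K) (f : MvPolynomial (Fin n) K) :
    coordChange g⁻¹ (coordChange g f) = f :=
  coordChange_comp_of_mul_eq_one (inv_mul_cancel g) f

theorem coordChange_injective (g : GL (Fin n) K) : Function.Injective (coordChange g) :=
  Function.LeftInverse.injective (coordChange_apply_inv g)

theorem totalDegree_coordChange_le (g : GL (Fin n) K) (f : MvPolynomial (Fin n) K) :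
    (coordChange g f).totalDegree ≤ f.totalDegree := by
  have hlin : ∀ j, (∑ i, C ((g : Matrix (Fin n) (Fin n) K) i j) * X i :
      MvPolynomial (Fin n) K).IsHomogeneous 1 := fun j =>
    IsHomogeneous.sum _ _ _ fun i _ => by
      simpa using (isHomogeneous_C (Fin n) _).mul (isHomogeneous_X K i)
  conv_lhs => rw [← sum_homogeneousComponent f, map_sum]
  refine (totalDegree_finsetSum _ _).trans (Finset.sup_le fun i hi => ?_)
  have h := (homogeneousComponent_isHomogeneous i f).aeval _ hlin
  rw [one_mul] at h
  exact h.totalDegree_le.trans (Nat.lt_succ_iff.mp (Finset.mem_range.mp hi))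

/-- The coefficients of `coordChange g f` are polynomial functions of `g`. -/
theorem exists_eval_eq_coeff_coordChange (f : MvPolynomial (Fin n) K) (a : Fin n →₀ ℕ) :
    ∃ p : MvPolynomial (Fin n × Fin n) K, ∀ g : GL (Fin n) K,
      eval (fun e => (g : Matrix (Fin n) (Fin n) K) e.1 e.2) p = coeff a (coordChange g f) := by
  let G : MvPolynomial (Fin n) K →+* MvPolynomial (Fin n) (MvPolynomial (Fin n × Fin n) K) :=
    eval₂Hom (C.comp C) fun j => ∑ i, C (X (i, j)) * X i
  refine ⟨coeff a (G f), fun g => ?_⟩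
  rw [← coeff_map]
  congr 1
  suffices H : (MvPolynomial.map (eval fun e => (g : Matrix (Fin n) (Fin n) K) e.1 e.2)).comp G =
      (coordChange g).toRingHom from DFunLike.congr_fun H f
  ext j : 1
  · ext; simp [G, coordChange]
  · simp [G, coordChange]

/-! ### Generic leading exponents -/

/-- Semicontinuity: the number of leading exponents in a set `T` that is closed under passing to
larger exponents can only grow when a coordinate change is replaced by a generic one. -/
theorem eventually_ncard_leadExponents_inter_le (τ : MonomialOrder (Fin n))
    (V : Submodule K (MvPolynomial (Fin n) K)) [FiniteDimensional K V]
    {T : Set (Fin n →₀ ℕ)} (hT : ∀ a ∈ T, ∀ b, a ≼[τ] b → b ∈ T) (g₀ : GL (Fin n) K) :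
    ∀ᶠ g in genericFilter n K,
      (leadExponents τ (V.map (coordChange g₀).toLinearMap) ∩ T).ncard ≤
        (leadExponents τ (V.map (coordChange g).toLinearMap) ∩ T).ncard := by
  have hfin := (leadExponents_finite τ (V.map (coordChange g₀).toLinearMap)).inter_of_left T
  set S := hfin.toFinset with hSdef
  have hS : ∀ j : S, ∃ v ∈ V, coordChange g₀ v ≠ 0 ∧ τ.degree (coordChange g₀ v) = j := by
    rintro ⟨j, hj⟩
    obtain ⟨⟨f, ⟨v, hv, rfl⟩, hf0, hf⟩, -⟩ := hfin.mem_toFinset.mp hj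
    exact ⟨v, hv, hf0, hf⟩
  choose v hvV hv0 hv using hS
  -- the minor of the coefficients of the `g(v j)` at the exponents in `S`, as a polynomial in `g`;
  -- at `g₀` it is triangular with nonzero diagonal
  choose p hp using fun i j : S => exists_eval_eq_coeff_coordChange (v j) i
  have hdet : ∀ g : GL (Fin n) K,
      eval (fun e => (g : Matrix (Fin n) (Fin n) K) e.1 e.2) (Matrix.of p).det =
        (Matrix.of fun i j : S => coeff (i : Fin n →₀ ℕ) (coordChange g (v j))).det := by
    intro g
    rw [RingHom.map_det]
    congr 1
    ext i j
    simp [hp]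
  have hmul : ∀ (g : GL (Fin n) K) (c : S → K) (i : S),
      ((Matrix.of fun i j : S => coeff (i : Fin n →₀ ℕ) (coordChange g (v j))).mulVec c) i =
        coeff i (∑ j, c j • coordChange g (v j)) := by
    intro g c i
    simp only [Matrix.mulVec, dotProduct, Matrix.of_apply, coeff_sum, coeff_smul, smul_eq_mul]
    exact Finset.sum_congr rfl fun j _ => mul_comm _ _
  refine eventually_genericFilter_iff.mpr ⟨(Matrix.of p).det, fun h0 => ?_, fun g hg => ?_⟩
  · have h := hdet g₀
    rw [h0, map_zero, eq_comm, ← Matrix.exists_mulVec_eq_zero_iff] at h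
    obtain ⟨c, hc, hMc⟩ := h
    obtain ⟨i, hi⟩ := exists_coeff_sum_ne_zero τ hv0 hv hc
    exact hi (by rw [← hmul, hMc, Pi.zero_apply])
  · rw [hdet] at hg
    have hker : ∀ c : S → K, (∀ i : S, coeff (i : Fin n →₀ ℕ)
        (∑ j, c j • coordChange g (v j)) = 0) → c = 0 := by
      intro c hc
      by_contra hne
      exact hg (Matrix.exists_mulVec_eq_zero_iff.mp
        ⟨c, hne, funext fun i => by rw [hmul, hc, Pi.zero_apply]⟩)
    have hli : LinearIndependent K fun j : S => coordChange g (v j) := by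
      rw [Fintype.linearIndependent_iff]
      intro c hc
      exact congrFun (hker c fun i => by rw [hc, coeff_zero])
    have hle : Submodule.span K (Set.range fun j : S => coordChange g (v j)) ≤
        V.map (coordChange g).toLinearMap := by
      rw [Submodule.span_le]
      rintro _ ⟨j, rfl⟩
      exact ⟨v j, hvV j, rfl⟩
    have hcard := finrank_span_eq_card hli
    rw [Fintype.card_coe] at hcard
    rw [Set.ncard_eq_toFinset_card _ hfin, ← hSdef, ← hcard]
    refine finrank_le_ncard_leadExponents_inter τ hle (S := S) (T := T)
      (fun i hi => (hfin.mem_toFinset.mp hi).2) hT fun f hf hf0 => ?_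
    obtain ⟨c, rfl⟩ := (Submodule.mem_span_range_iff_exists_fun K).mp hf
    by_contra! hcon
    apply hf0
    rw [hker c fun i => hcon i i.2]
    simp

/-- A finite set of exponents is determined by how many elements it has above each exponent. -/
theorem eq_of_ncard_inter_eq (τ : MonomialOrder (Fin n)) {A B : Set (Fin n →₀ ℕ)}
    (hA : A.Finite) (hB : B.Finite)
    (h : ∀ a ∈ A ∪ B, (A ∩ {b | a ≼[τ] b}).ncard = (B ∩ {b | a ≼[τ] b}).ncard) : A = B := by
  by_contra hne
  obtain ⟨a, ha, hmax⟩ := Set.exists_max_image (symmDiff A B) τ.toSyn (hA.symmDiff hB)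
    (Set.nonempty_iff_ne_empty.mpr fun h => hne (symmDiff_eq_bot.mp h))
  -- by maximality of `a`, the two sets agree above `a`, so they cannot differ at `a` itself
  suffices key : ∀ A B : Set (Fin n →₀ ℕ), A.Finite → a ∈ A → a ∉ B →
      (∀ b ∈ symmDiff A B, b ≼[τ] a) →
      (A ∩ {b | a ≼[τ] b}).ncard ≠ (B ∩ {b | a ≼[τ] b}).ncard by
    rcases ha with ⟨haA, haB⟩ | ⟨haB, haA⟩
    · exact key A B hA haA haB hmax (h a (.inl haA))
    · exact key B A hB haB haA (symmDiff_comm A B ▸ hmax) (h a (.inr haB)).symm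
  intro A B hA haA haB hmax
  refine (Set.ncard_lt_ncard ⟨?_, fun hsub => haB (hsub ⟨haA, le_rfl⟩).1⟩
    (hA.inter_of_left _)).ne'
  rintro b ⟨hbB, hab⟩
  refine ⟨?_, hab⟩
  by_contra hbA
  have := τ.toSyn.injective (le_antisymm hab (hmax b (.inr ⟨hbB, hbA⟩)))
  exact haB (this ▸ hbB)

/-- For a finite-dimensional space `V` of polynomials the set of leading exponents of `g(V)` is
the same set `S` for generic `g`. -/
theorem exists_eventually_leadExponents_map_eq [Infinite K] (τ : MonomialOrder (Fin n))
    (V : Submodule K (MvPolynomial (Fin n) K)) [FiniteDimensional K V]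
    {F : Set (Fin n →₀ ℕ)} (hF : F.Finite)
    (hVF : ∀ g, leadExponents τ (V.map (coordChange g).toLinearMap) ⊆ F) :
    ∃ S, ∀ᶠ g in genericFilter n K, leadExponents τ (V.map (coordChange g).toLinearMap) = S := by
  let T : (Fin n →₀ ℕ) → Set (Fin n →₀ ℕ) := fun a => {b | a ≼[τ] b}
  have hT : ∀ a, ∀ b ∈ T a, ∀ c, b ≼[τ] c → c ∈ T a := fun a b hb c hc => le_trans hb hc
  have hmax : ∀ a, ∃ r, ∀ᶠ g in genericFilter n K,
      (leadExponents τ (V.map (coordChange g).toLinearMap) ∩ T a).ncard = r := by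
    intro a
    have hbdd : (Set.range fun g : GL (Fin n) K =>
        (leadExponents τ (V.map (coordChange g).toLinearMap) ∩ T a).ncard).Finite := by
      refine (Set.finite_Iic F.ncard).subset ?_
      rintro _ ⟨g, rfl⟩
      exact Set.ncard_le_ncard (Set.inter_subset_left.trans (hVF g)) hF
    obtain ⟨r, ⟨⟨g₀, rfl⟩, hmax⟩⟩ := hbdd.exists_maximal (Set.range_nonempty _)
    refine ⟨(leadExponents τ (V.map (coordChange g₀).toLinearMap) ∩ T a).ncard,
      (eventually_ncard_leadExponents_inter_le τ V (hT a) g₀).mono fun g hg => ?_⟩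
    exact le_antisymm (hmax ⟨g, rfl⟩ hg) hg
  choose r hr using hmax
  have hall : ∀ᶠ g in genericFilter n K, ∀ a ∈ F,
      (leadExponents τ (V.map (coordChange g).toLinearMap) ∩ T a).ncard = r a :=
    (Filter.eventually_all_finite hF).mpr fun a _ => hr a
  obtain ⟨g₁, hg₁⟩ := hall.exists
  refine ⟨leadExponents τ (V.map (coordChange g₁).toLinearMap), hall.mono fun g hg => ?_⟩
  exact eq_of_ncard_inter_eq τ (hF.subset (hVF g)) (hF.subset (hVF g₁))
    fun a ha => (hg a (Set.union_subset (hVF g) (hVF g₁) ha)).trans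
      (hg₁ a (Set.union_subset (hVF g) (hVF g₁) ha)).symm

/-! ### Existence of generic initial ideals -/

/-- The elements of total degree at most `e` of an ideal. -/
noncomputable def degreeLE (I : Ideal (MvPolynomial (Fin n) K)) (e : ℕ) :
    Submodule K (MvPolynomial (Fin n) K) :=
  I.restrictScalars K ⊓ restrictTotalDegree (Fin n) K e

theorem mem_degreeLE {I : Ideal (MvPolynomial (Fin n) K)} {e : ℕ} {f : MvPolynomial (Fin n) K} :
    f ∈ degreeLE I e ↔ f ∈ I ∧ f.totalDegree ≤ e := by
  rw [degreeLE, Submodule.mem_inf, mem_restrictTotalDegree, Submodule.restrictScalars_mem]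

instance (I : Ideal (MvPolynomial (Fin n) K)) (e : ℕ) : FiniteDimensional K (degreeLE I e) :=
  Submodule.finiteDimensional_of_le (inf_le_right : _ ≤ restrictTotalDegree (Fin n) K e)

theorem mem_map_coordChange_iff {I : Ideal (MvPolynomial (Fin n) K)} {g : GL (Fin n) K}
    {f : MvPolynomial (Fin n) K} : f ∈ I.map (coordChange g) ↔ ∃ h ∈ I, coordChange g h = f :=
  Ideal.mem_map_iff_of_surjective (coordChange g)
    (Function.RightInverse.surjective (coordChange_inv_apply g))

theorem map_degreeLE (I : Ideal (MvPolynomial (Fin n) K)) (e : ℕ) (g : GL (Fin n) K) :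
    (degreeLE I e).map (coordChange g).toLinearMap = degreeLE (I.map (coordChange g)) e := by
  ext f
  simp only [Submodule.mem_map, mem_degreeLE, mem_map_coordChange_iff, AlgHom.toLinearMap_apply]
  constructor
  · rintro ⟨h, ⟨hI, hdeg⟩, rfl⟩
    exact ⟨⟨h, hI, rfl⟩, (totalDegree_coordChange_le g h).trans hdeg⟩
  · rintro ⟨⟨h, hI, rfl⟩, hdeg⟩
    refine ⟨h, ⟨hI, ?_⟩, rfl⟩
    rw [← coordChange_apply_inv g h]
    exact (totalDegree_coordChange_le _ _).trans hdeg

theorem finrank_degreeLE_map (I : Ideal (MvPolynomial (Fin n) K)) (e : ℕ) (g : GL (Fin n) K) :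
    finrank K (degreeLE (I.map (coordChange g)) e) = finrank K (degreeLE I e) := by
  rw [← map_degreeLE]
  exact (Submodule.equivMapOfInjective _ (coordChange_injective g) _).symm.finrank_eq

theorem totalDegree_le_iff_degree_le {τ : MonomialOrder (Fin n)} (hτ : IsGradedStandard τ)
    {f : MvPolynomial (Fin n) K} (hf : f ≠ 0) {e : ℕ} :
    f.totalDegree ≤ e ↔ (τ.degree f).degree ≤ e := by
  constructor
  · exact (le_totalDegree (τ.degree_mem_support hf)).trans
  · intro h
    refine Finset.sup_le fun b hb => ?_
    by_contra! hlt
    exact absurd (τ.le_degree hb) (not_le.mpr (hτ.graded _ b (h.trans_lt hlt)))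

theorem leadExponents_degreeLE {τ : MonomialOrder (Fin n)} (hτ : IsGradedStandard τ)
    (I : Ideal (MvPolynomial (Fin n) K)) (e : ℕ) :
    leadExponents τ (degreeLE I e) =
      leadExponents τ (I.restrictScalars K) ∩ {a | a.degree ≤ e} := by
  ext a
  constructor
  · rintro ⟨f, hf, hf0, rfl⟩
    rw [mem_degreeLE] at hf
    exact ⟨⟨f, hf.1, hf0, rfl⟩, (totalDegree_le_iff_degree_le hτ hf0).mp hf.2⟩
  · rintro ⟨⟨f, hf, hf0, rfl⟩, ha⟩
    exact ⟨f, mem_degreeLE.mpr ⟨hf, (totalDegree_le_iff_degree_le hτ hf0).mpr ha⟩, hf0, rfl⟩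

theorem mem_leadExponents_of_le {τ : MonomialOrder (Fin n)}
    {I : Ideal (MvPolynomial (Fin n) K)} {a b : Fin n →₀ ℕ}
    (ha : a ∈ leadExponents τ (I.restrictScalars K)) (hab : a ≤ b) :
    b ∈ leadExponents τ (I.restrictScalars K) := by
  obtain ⟨f, hf, hf0, rfl⟩ := ha
  have hm : monomial (b - τ.degree f) (1 : K) ≠ 0 := by simp
  refine ⟨monomial (b - τ.degree f) 1 * f, I.mul_mem_left _ hf, mul_ne_zero hm hf0, ?_⟩
  classical
  rw [τ.degree_mul hm hf0, τ.degree_monomial, if_neg one_ne_zero]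
  exact tsub_add_cancel_of_le hab

theorem initialIdeal_eq_span_monomial (τ : MonomialOrder (Fin n))
    (I : Ideal (MvPolynomial (Fin n) K)) :
    initialIdeal τ I =
      Ideal.span ((fun a => monomial a (1 : K)) '' leadExponents τ (I.restrictScalars K)) := by
  apply le_antisymm <;> rw [initialIdeal, Ideal.span_le]
  · rintro _ ⟨f, hf, rfl⟩
    rw [← τ.C_mul_leadingCoeff_monomial_degree]
    by_cases hf0 : f = 0
    · simp [hf0]
    · exact Ideal.mul_mem_left _ _ (Ideal.subset_span ⟨_, ⟨f, hf, hf0, rfl⟩, rfl⟩)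
  · rintro _ ⟨_, ⟨f, hf, hf0, rfl⟩, rfl⟩
    have hmem : C (τ.leadingCoeff f)⁻¹ * τ.leadingTerm f ∈ Ideal.span (τ.leadingTerm '' I) :=
      Ideal.mul_mem_left _ _ (Ideal.subset_span ⟨f, hf, rfl⟩)
    rwa [MonomialOrder.leadingTerm, C_mul_monomial,
      inv_mul_cancel₀ (τ.leadingCoeff_ne_zero_iff.mpr hf0)] at hmem

/-- The leading exponents of `g(I)` are the same for generic `g`. In each bounded degree this
follows from semicontinuity. By Dickson's lemma, finitely many degrees suffice to force all
generic leading exponents into those of `g(I)`, and since `g(I)` has the same Hilbert function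
as `I`, there is no room for any others. -/
theorem exists_eventually_leadExponents_eq [Infinite K] {τ : MonomialOrder (Fin n)}
    (hτ : IsGradedStandard τ) (I : Ideal (MvPolynomial (Fin n) K)) :
    ∃ S, ∀ᶠ g in genericFilter n K,
      leadExponents τ ((I.map (coordChange g)).restrictScalars K) = S := by
  have hstep : ∀ e, ∃ S, ∀ᶠ g in genericFilter n K,
      leadExponents τ (degreeLE (I.map (coordChange g)) e) = S := by
    intro e
    simp only [← map_degreeLE]
    refine exists_eventually_leadExponents_map_eq τ _ (Finsupp.finite_of_degree_le e) fun g => ?_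
    rw [map_degreeLE, leadExponents_degreeLE hτ]
    exact Set.inter_subset_right
  choose S hS using hstep
  let U : Set (Fin n →₀ ℕ) := ⋃ e, S e
  -- the generic exponents found in different degree bounds are compatible, since two generic
  -- conditions hold at a common `g`
  have hSU : ∀ e, S e = U ∩ {a | a.degree ≤ e} := by
    intro e
    ext a
    simp only [U, Set.mem_inter_iff, Set.mem_iUnion, Set.mem_ofPred_eq]
    constructor
    · intro ha
      obtain ⟨g, hg⟩ := (hS e).exists
      rw [leadExponents_degreeLE hτ] at hg
      exact ⟨⟨e, ha⟩, (hg.symm ▸ ha : a ∈ _ ∩ {a : Fin n →₀ ℕ | a.degree ≤ e}).2⟩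
    · rintro ⟨⟨e', ha⟩, hae⟩
      obtain ⟨g, hg, hg'⟩ := ((hS e).and (hS e')).exists
      rw [leadExponents_degreeLE hτ] at hg hg'
      rw [← hg' ] at ha
      rw [← hg]
      exact ⟨ha.1, hae⟩
  have hmin : {a | Minimal (· ∈ U) a}.Finite :=
    WellQuasiOrderedLE.finite_of_isAntichain (setOfPred_minimal_antichain _)
  have hgen : ∀ᶠ g in genericFilter n K, ∀ a ∈ {a | Minimal (· ∈ U) a},
      a ∈ leadExponents τ ((I.map (coordChange g)).restrictScalars K) := by
    refine (Filter.eventually_all_finite hmin).mpr fun a ha => (hS a.degree).mono fun g hg => ?_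
    have haS : a ∈ S a.degree := by rw [hSU]; exact ⟨ha.1, le_refl a.degree⟩
    rw [← hg, leadExponents_degreeLE hτ] at haS
    exact haS.1
  refine ⟨U, hgen.mono fun g hg => ?_⟩
  have hsub : U ⊆ leadExponents τ ((I.map (coordChange g)).restrictScalars K) := by
    intro a ha
    obtain ⟨b, hba, hb⟩ := (Set.isPWO_of_wellQuasiOrderedLE U).exists_le_minimal ha
    exact mem_leadExponents_of_le (hg b hb) hba
  refine Set.Subset.antisymm (fun a ha => ?_) hsub
  suffices h : S a.degree = leadExponents τ (degreeLE (I.map (coordChange g)) a.degree) by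
    have : a ∈ S a.degree := by
      rw [h, leadExponents_degreeLE hτ]
      exact ⟨ha, le_refl a.degree⟩
    rw [hSU] at this
    exact this.1
  refine Set.eq_of_subset_of_ncard_le ?_ ?_ (leadExponents_finite τ _)
  · rw [hSU, leadExponents_degreeLE hτ]
    exact Set.inter_subset_inter_left _ hsub
  · obtain ⟨g', hg'⟩ := (hS a.degree).exists
    rw [← hg', ncard_leadExponents, ncard_leadExponents, finrank_degreeLE_map,
      finrank_degreeLE_map]

theorem exists_isGenericInitialIdeal [Infinite K] {τ : MonomialOrder (Fin n)}
    (hτ : IsGradedStandard τ) (I : Ideal (MvPolynomial (Fin n) K)) :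
    ∃ J, IsGenericInitialIdeal τ I J := by
  obtain ⟨S, hS⟩ := exists_eventually_leadExponents_eq hτ I
  exact ⟨_, isGenericInitialIdeal_of_eventually (hS.mono fun g hg => by
    rw [initialIdeal_eq_span_monomial, hg])⟩

theorem isGenericInitialIdeal_gin [Infinite K] {τ : MonomialOrder (Fin n)}
    (hτ : IsGradedStandard τ) (I : Ideal (MvPolynomial (Fin n) K)) :
    IsGenericInitialIdeal τ I (gin τ I) :=
  Classical.epsilon_spec (exists_isGenericInitialIdeal hτ I)

theorem eventually_initialIdeal_eq_gin [Infinite K] {τ : MonomialOrder (Fin n)}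
    (hτ : IsGradedStandard τ) (I : Ideal (MvPolynomial (Fin n) K)) :
    ∀ᶠ g in genericFilter n K, initialIdeal τ (I.map (coordChange g)) = gin τ I := by
  obtain ⟨S, hS⟩ := exists_eventually_leadExponents_eq hτ I
  have h := hS.mono fun g hg => (by rw [initialIdeal_eq_span_monomial, hg] :
    initialIdeal τ (I.map (coordChange g)) = Ideal.span ((fun a => monomial a (1 : K)) '' S))
  rwa [(isGenericInitialIdeal_of_eventually h).unique (isGenericInitialIdeal_gin hτ I)] at h

/-! ### The degree `d` part of a generic initial ideal -/

theorem degreePart_initialIdeal (τ : MonomialOrder (Fin n))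
    (I : Ideal (MvPolynomial (Fin n) K)) (d : ℕ) :
    degreePart (initialIdeal τ I) d =
      restrictSupport K (leadExponents τ (I.restrictScalars K) ∩ {a | a.degree = d}) := by
  ext f
  rw [degreePart, Submodule.mem_inf, Submodule.restrictScalars_mem, initialIdeal_eq_span_monomial,
    mem_ideal_span_monomial_image, homogeneousSubmodule_eq_finsupp_supported,
    mem_restrictSupport_iff, Set.subset_inter_iff]
  refine and_congr ⟨fun h a ha => ?_, fun h a ha => ⟨a, h ha, le_rfl⟩⟩ Iff.rfl
  obtain ⟨b, hb, hba⟩ := h a ha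
  exact mem_leadExponents_of_le hb hba

/-- Suppose that the largest monomials of degree `d` all lead elements of `I`, and that there are
as many of them as the dimension of `I` in degrees up to `d` allows. Then they span the degree
`d` part of the generic initial ideal. -/
theorem degreePart_gin_eq_restrictSupport [Infinite K] {τ : MonomialOrder (Fin n)}
    (hτ : IsGradedStandard τ) (I : Ideal (MvPolynomial (Fin n) K)) {d : ℕ}
    {A : Finset (Fin n →₀ ℕ)} (hcard : finrank K (degreeLE I d) ≤ A.card)
    (hA : ∀ a ∈ A, a ∈ leadExponents τ (I.restrictScalars K)) (hd : ∀ a ∈ A, a.degree = d)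
    (hup : ∀ a ∈ A, ∀ b, b.degree = d → a ≼[τ] b → b ∈ A) :
    degreePart (gin τ I) d = restrictSupport K A := by
  let T : Set (Fin n →₀ ℕ) := {b | ∃ a ∈ A, a ≼[τ] b}
  have hone : I.map (coordChange (1 : GL (Fin n) K)) = I := by simp [coordChange_one]
  obtain ⟨g, hg, hgT⟩ := ((eventually_initialIdeal_eq_gin hτ I).and
    (eventually_ncard_leadExponents_inter_le τ (degreeLE I d) (T := T)
      (fun a ⟨c, hc, hca⟩ b hab => ⟨c, hc, hca.trans hab⟩) 1)).exists
  rw [map_degreeLE, map_degreeLE, hone] at hgT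
  have hfin := leadExponents_finite τ (degreeLE (I.map (coordChange g)) d)
  have hAT : (A : Set (Fin n →₀ ℕ)) ⊆ leadExponents τ (degreeLE I d) ∩ T := fun a ha => by
    rw [leadExponents_degreeLE hτ]
    exact ⟨⟨hA a ha, (hd a ha).le⟩, a, ha, le_rfl⟩
  have hle := (Set.ncard_le_ncard hAT ((leadExponents_finite τ _).inter_of_left T)).trans hgT
  have hTA : leadExponents τ (degreeLE (I.map (coordChange g)) d) ∩ T ⊆ A := by
    rintro b ⟨hb, a, ha, hab⟩
    rw [leadExponents_degreeLE hτ] at hb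
    refine hup a ha b (le_antisymm hb.2 ?_) hab
    by_contra! hlt
    rw [← hd a ha] at hlt
    exact absurd hab (not_le.mpr (hτ.graded _ _ hlt))
  have hEq := Set.eq_of_subset_of_ncard_le hTA hle
  have hlead : (A : Set (Fin n →₀ ℕ)) = leadExponents τ (degreeLE (I.map (coordChange g)) d) := by
    refine Set.eq_of_subset_of_ncard_le (hEq ▸ Set.inter_subset_left) ?_ hfin
    rwa [ncard_leadExponents, finrank_degreeLE_map, Set.ncard_coe_finset]
  rw [← hg, degreePart_initialIdeal]
  congr 1
  rw [leadExponents_degreeLE hτ] at hlead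
  ext a
  constructor
  · rintro ⟨ha, had⟩
    rw [hlead]
    exact ⟨ha, le_of_eq had⟩
  · intro ha
    have := hd a ha
    rw [hlead] at ha
    exact ⟨ha.1, this⟩

/-- An ideal generated by forms of degree `d` contains, in degrees up to `d`, only the linear
combinations of these forms. -/
theorem homogeneousComponent_mem_span {G : Set (MvPolynomial (Fin n) K)} {d : ℕ}
    (hG : ∀ f ∈ G, f.IsHomogeneous d) {f : MvPolynomial (Fin n) K} (hf : f ∈ Ideal.span G)
    {e : ℕ} (he : e ≤ d) : homogeneousComponent e f ∈ Submodule.span K G := by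
  induction hf using Submodule.closure_induction with
  | zero => simp
  | add x y _ _ hx hy => rw [map_add]; exact add_mem hx hy
  | smul_mem r x hx =>
    rw [smul_eq_mul, ← sum_homogeneousComponent r, Finset.sum_mul, map_sum]
    refine Submodule.sum_mem _ fun i _ => ?_
    rw [homogeneousComponent_of_mem ((homogeneousComponent_isHomogeneous i r).mul (hG x hx))]
    split_ifs with h
    · obtain rfl : i = 0 := by omega
      rw [homogeneousComponent_zero, ← smul_eq_C_mul]
      exact Submodule.smul_mem _ _ (Submodule.subset_span hx)
    · exact zero_mem _

theorem degreeLE_span_le {G : Set (MvPolynomial (Fin n) K)} {d : ℕ}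
    (hG : ∀ f ∈ G, f.IsHomogeneous d) : degreeLE (Ideal.span G) d ≤ Submodule.span K G := by
  intro f hf
  rw [mem_degreeLE] at hf
  rw [← sum_homogeneousComponent f]
  refine Submodule.sum_mem _ fun i hi => homogeneousComponent_mem_span hG hf.1 ?_
  have := Finset.mem_range.mp hi
  omega

/-! ### Lists of monomials -/

theorem mem_monomialList {τ : MonomialOrder (Fin n)} {d : ℕ} {a : Fin n →₀ ℕ} :
    a ∈ monomialList τ d ↔ a.degree = d := by
  simp only [monomialList, List.mem_map, Finset.mem_sort, Finset.mem_map,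
    Finset.mem_finsuppAntidiag, Finset.subset_univ, and_true, Finsupp.degree_eq_sum]
  constructor
  · rintro ⟨_, ⟨b, hb, rfl⟩, rfl⟩
    simpa using hb
  · exact fun h => ⟨τ.toSyn a, ⟨a, h, rfl⟩, by simp⟩

theorem pairwise_monomialList (τ : MonomialOrder (Fin n)) (d : ℕ) :
    (monomialList τ d).Pairwise fun a b => b ≺[τ] a := by
  rw [monomialList, List.pairwise_map]
  simpa using (Finset.sortedGT_sort _).pairwise

theorem length_monomialList (τ : MonomialOrder (Fin n)) (d : ℕ) :
    (monomialList τ d).length = ((Finset.univ : Finset (Fin n)).finsuppAntidiag d).card := by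
  simp [monomialList]

theorem nodup_monomialList (τ : MonomialOrder (Fin n)) (d : ℕ) : (monomialList τ d).Nodup :=
  (pairwise_monomialList τ d).imp fun h => by rintro rfl; exact lt_irrefl _ h

theorem getElem_monomialList_le_iff {τ : MonomialOrder (Fin n)} {d i j : ℕ}
    (hi : i < (monomialList τ d).length) (hj : j < (monomialList τ d).length) :
    (monomialList τ d)[i] ≼[τ] (monomialList τ d)[j] ↔ j ≤ i := by
  have h := List.pairwise_iff_getElem.mp (pairwise_monomialList τ d)
  constructor
  · intro hle
    by_contra! hlt
    exact absurd hle (not_le.mpr (h i j hi hj hlt))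
  · intro hle
    rcases hle.eq_or_lt with rfl | hlt
    · exact le_rfl
    · exact (h j i hj hi hlt).le

theorem notMem_take_monomialList {τ : MonomialOrder (Fin n)} {d k : ℕ} {a : Fin n →₀ ℕ}
    (ha : (monomialList τ d)[k]? = some a) : a ∉ (monomialList τ d).take k := by
  intro hmem
  obtain ⟨hk, hak⟩ := List.getElem?_eq_some_iff.mp ha
  obtain ⟨i, hi, hia⟩ := List.mem_take_iff_getElem.mp hmem
  have := (nodup_monomialList τ d).getElem_inj_iff.mp (hia.trans hak.symm)
  omega

theorem mem_take_monomialList_of_le {τ : MonomialOrder (Fin n)} {d k : ℕ} {a b : Fin n →₀ ℕ}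
    (ha : a ∈ (monomialList τ d).take k) (hb : b.degree = d) (hab : a ≼[τ] b) :
    b ∈ (monomialList τ d).take k := by
  obtain ⟨i, hi, rfl⟩ := List.mem_take_iff_getElem.mp ha
  obtain ⟨j, hj, rfl⟩ := List.mem_iff_getElem.mp (mem_monomialList (τ := τ).mpr hb)
  rw [getElem_monomialList_le_iff] at hab
  exact List.mem_take_iff_getElem.mpr ⟨j, by omega, rfl⟩

theorem exists_isFirstDifference {α : Type*} {L L' : List α} (hlen : L.length = L'.length)
    (hne : L ≠ L') : ∃ k m m', IsFirstDifference L L' k m m' := by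
  induction L generalizing L' with
  | nil => cases L' <;> simp_all
  | cons a L ih =>
    cases L' with
    | nil => simp at hlen
    | cons b L' =>
      by_cases hab : a = b
      · subst hab
        obtain ⟨k, m, m', h, h1, h2, h3⟩ := ih (by simpa using hlen) (by simpa using hne)
        exact ⟨k + 1, m, m', by simpa using h, by simpa using h1, by simpa using h2, h3⟩
      · exact ⟨0, a, b, by simp, by simp, by simp, hab⟩

theorem le_iff_le_of_monomialList_eq {τ₁ τ₂ : MonomialOrder (Fin n)} {a b : Fin n →₀ ℕ}
    (hab : a.degree = b.degree) (h : monomialList τ₁ b.degree = monomialList τ₂ b.degree) :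
    a ≼[τ₁] b ↔ a ≼[τ₂] b := by
  obtain ⟨i, hi, hia⟩ := List.mem_iff_getElem.mp (mem_monomialList (τ := τ₁).mpr hab)
  obtain ⟨j, hj, hjb⟩ := List.mem_iff_getElem.mp
    (mem_monomialList (τ := τ₁).mpr (rfl : b.degree = _))
  have h1 := getElem_monomialList_le_iff hi hj
  have h2 := getElem_monomialList_le_iff (τ := τ₂) (h ▸ hi) (h ▸ hj)
  simp only [← h] at h2
  rw [hia, hjb] at h1 h2
  rw [h1, h2]

theorem exists_isFirstDifference_monomialList {τ₁ τ₂ : MonomialOrder (Fin n)}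
    (h₁ : IsGradedStandard τ₁) (h₂ : IsGradedStandard τ₂)
    (hne : ¬ ∀ a b : Fin n →₀ ℕ, a ≼[τ₁] b ↔ a ≼[τ₂] b) :
    ∃ d k m m', IsFirstDifference (monomialList τ₁ d) (monomialList τ₂ d) k m m' := by
  by_contra! hno
  refine hne fun a b => ?_
  rcases lt_trichotomy a.degree b.degree with hlt | heq | hgt
  · exact iff_of_true (h₁.graded _ _ hlt).le (h₂.graded _ _ hlt).le
  · refine le_iff_le_of_monomialList_eq heq ?_
    by_contra hL
    obtain ⟨k, m, m', h⟩ := exists_isFirstDifference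
      (by rw [length_monomialList, length_monomialList]) hL
    exact hno _ k m m' h
  · exact iff_of_false (h₁.graded _ _ hgt).not_ge (h₂.graded _ _ hgt).not_ge

/-! ### Ideals that distinguish monomial orders -/

/-- The leading monomial of `m + m'` is `m`, because `m` is the largest monomial of degree `d` not
in the list. So already without a coordinate change the ideal has the largest leading monomials
possible, one for each generator. -/
theorem degreePart_gin_monomialBinomialIdeal [Infinite K] {τ : MonomialOrder (Fin n)}
    (hτ : IsGradedStandard τ) {d k : ℕ} {m m' : Fin n →₀ ℕ}
    (hm : (monomialList τ d)[k]? = some m) (hm'd : m'.degree = d)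
    (hm' : m' ∉ (monomialList τ d).take k) (hne : m ≠ m') :
    degreePart (gin τ (monomialBinomialIdeal K ((monomialList τ d).take k) m m')) d =
      monomialSpan K ((monomialList τ d).take (k + 1)) := by
  classical
  obtain ⟨hk, hmk⟩ := List.getElem?_eq_some_iff.mp hm
  have hmd : m.degree = d := mem_monomialList.mp (List.mem_of_getElem? hm)
  have htake : (monomialList τ d).take (k + 1) = (monomialList τ d).take k ++ [m] := by
    rw [List.take_add_one, hm, Option.toList_some]
  have hlt : m' ≺[τ] m := by
    obtain ⟨j, hj, hjm⟩ := List.mem_iff_getElem.mp (mem_monomialList (τ := τ).mpr hm'd)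
    refine lt_of_le_of_ne ?_ fun h => hne (τ.toSyn.injective h).symm
    rw [← hjm, ← hmk, getElem_monomialList_le_iff]
    by_contra! hjk
    exact hm' (hjm ▸ List.mem_take_iff_getElem.mpr ⟨j, by omega, rfl⟩)
  have hdeg : ∀ a ∈ (monomialList τ d).take (k + 1), a.degree = d := fun a ha =>
    mem_monomialList.mp (List.mem_of_mem_take ha)
  have hdegk : ∀ a ∈ (monomialList τ d).take k, a.degree = d := fun a ha =>
    mem_monomialList.mp (List.mem_of_mem_take ha)
  set L := (monomialList τ d).take k with hL
  set G : Finset (MvPolynomial (Fin n) K) :=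
    L.toFinset.image (fun a => monomial a (1 : K)) ∪ {monomial m 1 + monomial m' 1} with hGdef
  have hI : monomialBinomialIdeal K L m m' = Ideal.span (G : Set (MvPolynomial (Fin n) K)) := by
    simp [monomialBinomialIdeal, hGdef, L]
  have hG : ∀ f ∈ (G : Set (MvPolynomial (Fin n) K)), f.IsHomogeneous d := by
    intro f hf
    rw [hGdef, Finset.mem_coe, Finset.mem_union, Finset.mem_image, Finset.mem_singleton] at hf
    rcases hf with ⟨a, ha, rfl⟩ | rfl
    · exact isHomogeneous_monomial _ (hdegk a (List.mem_toFinset.mp ha))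
    · exact (isHomogeneous_monomial _ hmd).add (isHomogeneous_monomial _ hm'd)
  have hcardA : ((monomialList τ d).take (k + 1)).toFinset.card = k + 1 := by
    rw [List.toFinset_card_of_nodup ((nodup_monomialList τ d).sublist (List.take_sublist _ _)),
      List.length_take]
    omega
  rw [degreePart_gin_eq_restrictSupport hτ _ (A := ((monomialList τ d).take (k + 1)).toFinset),
    restrictSupport_eq_span, monomialSpan]
  · simp
  · rw [hI, hcardA]
    refine (Submodule.finrank_mono (degreeLE_span_le hG)).trans
      ((finrank_span_finset_le_card G).trans ((Finset.card_union_le _ _).trans ?_))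
    rw [Finset.card_singleton]
    refine Nat.add_le_add_right (Finset.card_image_le.trans (L.toFinset_card_le.trans ?_)) 1
    exact List.length_take_le _ _
  · intro a ha
    rw [List.mem_toFinset, htake, List.mem_append, List.mem_singleton] at ha
    rcases ha with ha | rfl
    · exact ⟨monomial a 1, Ideal.subset_span (.inl ⟨a, ha, rfl⟩), by simp,
        by rw [τ.degree_monomial, if_neg one_ne_zero]⟩
    · have hdega : τ.degree (monomial a (1 : K) + monomial m' 1) = a := by
        rw [τ.degree_add_of_lt] <;> simp [τ.degree_monomial, hlt]
      refine ⟨_, Ideal.subset_span (.inr rfl), fun h0 => ?_, hdega⟩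
      have := congrArg (coeff a) h0
      rw [coeff_add, coeff_monomial, coeff_monomial, if_pos rfl, if_neg hne.symm] at this
      simp at this
  · exact fun a ha => hdeg a (List.mem_toFinset.mp ha)
  · exact fun a ha b hb hab =>
      List.mem_toFinset.mpr (mem_take_monomialList_of_le (List.mem_toFinset.mp ha) hb hab)

theorem gin_congr {τ₁ τ₂ : MonomialOrder (Fin n)}
    (h : ∀ a b : Fin n →₀ ℕ, a ≼[τ₁] b ↔ a ≼[τ₂] b) (I : Ideal (MvPolynomial (Fin n) K)) :
    gin τ₁ I = gin τ₂ I := by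
  have hdeg : ∀ f : MvPolynomial (Fin n) K, τ₁.degree f = τ₂.degree f := by
    intro f
    by_cases hf : f = 0
    · simp [hf]
    · exact τ₂.toSyn.injective (le_antisymm (τ₂.le_degree (τ₁.degree_mem_support hf))
        ((h _ _).mp (τ₁.le_degree (τ₂.degree_mem_support hf))))
  have hlead : (τ₁.leadingTerm : MvPolynomial (Fin n) K → _) = τ₂.leadingTerm := by
    funext f
    simp only [MonomialOrder.leadingTerm, MonomialOrder.leadingCoeff, hdeg]
  have hgin : IsGenericInitialIdeal (K := K) τ₁ = IsGenericInitialIdeal τ₂ := by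
    funext I J
    simp only [IsGenericInitialIdeal, initialIdeal, hlead]
  rw [gin, gin, hgin]

theorem monomialBinomialIdeal_comm (L : List (Fin n →₀ ℕ)) (m m' : Fin n →₀ ℕ) :
    monomialBinomialIdeal K L m m' = monomialBinomialIdeal K L m' m := by
  rw [monomialBinomialIdeal, monomialBinomialIdeal, add_comm]

theorem monomial_mem_monomialSpan_iff {L : List (Fin n →₀ ℕ)} {a : Fin n →₀ ℕ} :
    monomial a (1 : K) ∈ monomialSpan K L ↔ a ∈ L := by
  rw [monomialSpan, ← restrictSupport_eq_span, monomial_mem_restrictSupport]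
  simp

theorem degreePart_gin_of_isFirstDifference [Infinite K] {τ₁ τ₂ : MonomialOrder (Fin n)}
    (h₁ : IsGradedStandard τ₁) (h₂ : IsGradedStandard τ₂) {d k : ℕ} {m m' : Fin n →₀ ℕ}
    (h : IsFirstDifference (monomialList τ₁ d) (monomialList τ₂ d) k m m') :
    degreePart (gin τ₁ (monomialBinomialIdeal K ((monomialList τ₁ d).take k) m m')) d =
        monomialSpan K ((monomialList τ₁ d).take (k + 1)) ∧
      degreePart (gin τ₂ (monomialBinomialIdeal K ((monomialList τ₁ d).take k) m m')) d =
        monomialSpan K ((monomialList τ₂ d).take (k + 1)) ∧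
      monomialSpan K ((monomialList τ₁ d).take (k + 1)) ≠
        monomialSpan K ((monomialList τ₂ d).take (k + 1)) := by
  obtain ⟨htake, hm, hm', hne⟩ := h
  have hmd := mem_monomialList.mp (List.mem_of_getElem? hm)
  have hm'd := mem_monomialList.mp (List.mem_of_getElem? hm')
  refine ⟨degreePart_gin_monomialBinomialIdeal h₁ hm hm'd
    (htake ▸ notMem_take_monomialList hm') hne, ?_, ?_⟩
  · rw [htake, monomialBinomialIdeal_comm]
    exact degreePart_gin_monomialBinomialIdeal h₂ hm' hmd
      (htake ▸ notMem_take_monomialList hm) hne.symm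
  · intro heq
    have hmem : m ∈ (monomialList τ₁ d).take (k + 1) := by
      rw [List.take_add_one, hm, Option.toList_some]
      exact List.mem_append_right _ (List.mem_singleton_self m)
    rw [← monomial_mem_monomialSpan_iff (K := K), heq, monomial_mem_monomialSpan_iff,
      List.take_add_one, hm', ← htake, Option.toList_some, List.mem_append,
      List.mem_singleton] at hmem
    exact hmem.elim (notMem_take_monomialList hm) hne

end GenericInitial

theorem theorem3p8 {n : ℕ} {K : Type*} [Field K] [IsAlgClosed K] [CharZero K]
    (τ₁ τ₂ : MonomialOrder (Fin n))
    (h₁ : GenericInitial.IsGradedStandard τ₁) (h₂ : GenericInitial.IsGradedStandard τ₂) :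
    -- generic initial ideals determine the order
    ((∀ I : Ideal (MvPolynomial (Fin n) K), GenericInitial.gin τ₁ I = GenericInitial.gin τ₂ I) ↔
      ∀ a b : Fin n →₀ ℕ, a ≼[τ₁] b ↔ a ≼[τ₂] b) ∧
    -- if the orders differ, then they differ on the monomials of some degree
    ((¬ ∀ a b : Fin n →₀ ℕ, a ≼[τ₁] b ↔ a ≼[τ₂] b) →
      ∃ (d k : ℕ) (m m' : Fin n →₀ ℕ), GenericInitial.IsFirstDifference
        (GenericInitial.monomialList τ₁ d) (GenericInitial.monomialList τ₂ d) k m m') ∧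
    -- and every first difference in a degree gives an ideal that tells the orders apart
    (∀ (d k : ℕ) (m m' : Fin n →₀ ℕ),
      GenericInitial.IsFirstDifference
        (GenericInitial.monomialList τ₁ d) (GenericInitial.monomialList τ₂ d) k m m' →
      ∀ I : Ideal (MvPolynomial (Fin n) K),
      I = GenericInitial.monomialBinomialIdeal K
        ((GenericInitial.monomialList τ₁ d).take k) m m' →
      GenericInitial.IsGenericInitialIdeal τ₁ I (GenericInitial.gin τ₁ I) ∧
      GenericInitial.IsGenericInitialIdeal τ₂ I (GenericInitial.gin τ₂ I) ∧
      GenericInitial.degreePart (GenericInitial.gin τ₁ I) d =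
        GenericInitial.monomialSpan K ((GenericInitial.monomialList τ₁ d).take (k + 1)) ∧
      GenericInitial.degreePart (GenericInitial.gin τ₂ I) d =
        GenericInitial.monomialSpan K ((GenericInitial.monomialList τ₂ d).take (k + 1)) ∧
      GenericInitial.degreePart (GenericInitial.gin τ₁ I) d ≠
        GenericInitial.degreePart (GenericInitial.gin τ₂ I) d) := by
  refine ⟨⟨fun h => ?_, fun h I => GenericInitial.gin_congr h I⟩,
    GenericInitial.exists_isFirstDifference_monomialList h₁ h₂, ?_⟩
  · by_contra hne
    obtain ⟨d, k, m, m', hfirst⟩ :=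
      GenericInitial.exists_isFirstDifference_monomialList h₁ h₂ hne
    obtain ⟨e₁, e₂, hspan⟩ :=
      GenericInitial.degreePart_gin_of_isFirstDifference (K := K) h₁ h₂ hfirst
    exact hspan (by rw [← e₁, ← e₂, h])
  · rintro d k m m' hfirst I rfl
    obtain ⟨e₁, e₂, hspan⟩ :=
      GenericInitial.degreePart_gin_of_isFirstDifference (K := K) h₁ h₂ hfirst
    exact ⟨GenericInitial.isGenericInitialIdeal_gin h₁ _,
      GenericInitial.isGenericInitialIdeal_gin h₂ _, e₁, e₂, by rwa [e₁, e₂]⟩
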